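/- Let $d,n\ge 0$ be integers. Let $SL_2(\mathbb{C})$ act on the binary $d$-forms $f=\sum_{i=0}^{d}\binom{d}{i}a_i x^{d-i}y^i$ with complex coefficients by $(g\cdot f)(v)=f(g^{-1}v)$, $v\in\mathbb{C}^2$. Let $C_d$ be the algebra of covariants of the binary $d$-form, that is, of the polynomials $F(f,v)$ in the coefficients $a_0,\dots,a_d$ of $f$ and the coordinates of $v\in\mathbb{C}^2$ such that $F(g\cdot f,g v)=F(f,v)$ for all $g\in SL_2(\mathbb{C})$, all $f$ and all $v$; let $(C_d)_n$ be the space of those covariants that are homogeneous of degree $n$ in $a_0,\dots,a_d$ (and of arbitrary degree in $v$). Let $S_d$ be the algebra of seminvariants of the binary $d$-form, that is, the kernel of the derivation $D_1$ of $\mathbb{C}[v_0,\dots,v_d]$ given by $D_1(v_0)=0$ and $D_1(v_i)=i\,v_{i-1}$ for $1\le i\le d$, and let $(S_d)_n$ be its subspace of homogeneous elements of degree $n$. Then $(C_d)_n$ and $(S_d)_n$ are finite-dimensional, and $$\dim (C_d)_n=\dim (S_d)_n=[(tz^d)^n]\left(\frac{1+z}{(1-t)(1-tz^2)\cdots(1-tz^{2d})}\right),$$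 where $[(tz^d)^n]A$ denotes the coefficient of $t^n z^{dn}$ in the formal power series $A\in\mathbb{C}[[t,z]]$. -/

import Mathlib

namespace BinaryForms

open MvPolynomial

/-! Binary forms and the natural action of `SL₂(ℂ)` on them. -/

/-- The binary `d`-form `∑ i, (d choose i) aᵢ x ^ (d - i) y ^ i` with coefficient vector `a`;
here `x = X 0` and `y = X 1`. -/
noncomputable def form (d : ℕ) (a : Fin (d + 1) → ℂ) : MvPolynomial (Fin 2) ℂ :=
  ∑ i : Fin (d + 1), C ((d.choose i : ℂ) * a i) * X 0 ^ (d - (i : ℕ)) * X 1 ^ (i : ℕ)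

/-- The natural left action of `g ∈ SL₂(ℂ)` on polynomials in two variables,
`(g • f)(v) = f (g⁻¹ v)`. -/
noncomputable def transform (g : Matrix.SpecialLinearGroup (Fin 2) ℂ) :
    MvPolynomial (Fin 2) ℂ →ₐ[ℂ] MvPolynomial (Fin 2) ℂ :=
  bind₁ fun i => ∑ j : Fin 2, C ((g⁻¹ : Matrix.SpecialLinearGroup (Fin 2) ℂ).val i j) * X j

/-- The `i`-th coordinate of a binary `d`-form: the number `aᵢ` in `form d a`. -/
noncomputable def coord (d : ℕ) (f : MvPolynomial (Fin 2) ℂ) (i : Fin (d + 1)) : ℂ :=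
  f.coeff (Finsupp.single 0 (d - (i : ℕ)) + Finsupp.single 1 (i : ℕ)) / (d.choose i : ℂ)

/-- The action of `SL₂(ℂ)` on binary `d`-forms, written in the coordinates `a₀, …, a_d`. -/
noncomputable def act (d : ℕ) (g : Matrix.SpecialLinearGroup (Fin 2) ℂ) (a : Fin (d + 1) → ℂ) :
    Fin (d + 1) → ℂ :=
  coord d (transform g (form d a))

/-! Covariants: polynomials in the coefficients `a₀, …, a_d` of a binary form and in a vector
of `ℂ²` that are invariant under the simultaneous action of `SL₂(ℂ)`. -/

/-- The algebra `C_d` of covariants of the binary `d`-form. -/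
noncomputable def covariants (d : ℕ) :
    Subalgebra ℂ (MvPolynomial (Fin (d + 1) ⊕ Fin 2) ℂ) where
  carrier := {F | ∀ (g : Matrix.SpecialLinearGroup (Fin 2) ℂ) (a : Fin (d + 1) → ℂ)
    (v : Fin 2 → ℂ),
      eval (Sum.elim (act d g a) (g.val.mulVec v)) F = eval (Sum.elim a v) F}
  mul_mem' := fun hF hG g a v => by rw [map_mul, map_mul, hF g a v, hG g a v]
  add_mem' := fun hF hG g a v => by rw [map_add, map_add, hF g a v, hG g a v]
  algebraMap_mem' := fun r g a v => by simp [algebraMap_eq]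

/-- The space `(C_d)_n` of covariants of degree `n`: those homogeneous of degree `n` in the
coefficients of the form (and of any order, that is, any degree in the vector variables). -/
noncomputable def covariantsOfDegree (d n : ℕ) :
    Submodule ℂ (MvPolynomial (Fin (d + 1) ⊕ Fin 2) ℂ) :=
  Subalgebra.toSubmodule (covariants d) ⊓
    weightedHomogeneousSubmodule ℂ (Sum.elim (fun _ => 1) (fun _ => 0) : _ → ℕ) n

/-! Seminvariants: the kernel of the derivation `D₁` on `S(V_d) = ℂ[v₀, …, v_d]`. -/

/-- The derivation `D₁` of `ℂ[v₀, …, v_d]` with `D₁ v₀ = 0` and `D₁ vᵢ = i vᵢ₋₁`. -/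
noncomputable def D₁ (d : ℕ) :
    Derivation ℂ (MvPolynomial (Fin (d + 1)) ℂ) (MvPolynomial (Fin (d + 1)) ℂ) :=
  mkDerivation ℂ fun i =>
    Fin.cases 0 (fun j : Fin d => C ((j : ℂ) + 1) * X j.castSucc) i

/-- The algebra `S_d` of seminvariants of the binary `d`-form. -/
noncomputable def seminvariants (d : ℕ) : Subalgebra ℂ (MvPolynomial (Fin (d + 1)) ℂ) where
  carrier := {F | D₁ d F = 0}
  mul_mem' := fun {F G} hF hG => by
    rw [Set.mem_ofPred_eq] at hF hG ⊢
    rw [Derivation.leibniz, hF, hG, smul_zero, smul_zero, add_zero]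
  add_mem' := fun {F G} hF hG => by
    rw [Set.mem_ofPred_eq] at hF hG ⊢
    rw [map_add, hF, hG, add_zero]
  algebraMap_mem' := fun r => (D₁ d).map_algebraMap r

/-- The space `(S_d)_n` of seminvariants that are homogeneous of degree `n`. -/
noncomputable def seminvariantsOfDegree (d n : ℕ) :
    Submodule ℂ (MvPolynomial (Fin (d + 1)) ℂ) :=
  Subalgebra.toSubmodule (seminvariants d) ⊓ homogeneousSubmodule (Fin (d + 1)) ℂ n

/-! The generating function, in `ℂ[[t, z]]` with `t = X 0` and `z = X 1`. -/

/-- The power series `(1 + z) / ((1 - t) (1 - t z ^ 2) ⋯ (1 - t z ^ (2 d)))`; the denominator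
has constant coefficient `1`, so `⁻¹` is its inverse in `ℂ[[t, z]]`. -/
noncomputable def genSeries (d : ℕ) : MvPowerSeries (Fin 2) ℂ :=
  (1 + MvPowerSeries.X 1) *
    (∏ k ∈ Finset.range (d + 1),
      (1 - MvPowerSeries.X 0 * MvPowerSeries.X 1 ^ (2 * k)))⁻¹

/-- The coefficient `[(t z ^ d) ^ n] A` of `t ^ n z ^ (d n)` in `A ∈ ℂ[[t, z]]`. -/
noncomputable def diagCoeff (d n : ℕ) (A : MvPowerSeries (Fin 2) ℂ) : ℂ :=
  MvPowerSeries.coeff (Finsupp.single 0 n + Finsupp.single 1 (d * n)) A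

end BinaryForms

/-! The seminvariants are counted by `sl₂`-theory. Give `vᵢ` weight `d - 2i`. On polynomials of
degree `n`, `D₁` raises the weight by `2`, `D₂` lowers it by `2`, and `[D₁, D₂]` is multiplication
by the weight. Hence `D₁` is injective on negative weights (`eq_zero_of_D₁_eq_zero`) and reaches all
of every positive weight (`exists_D₁_eq`). So its kernel lives in weights `≥ 0`, it maps weights `≥
0` onto weights `≥ 2`, and rank-nullity leaves the number of monomials of weight `0` or `1`. A
monomial of degree `n` and index sum `w` has weight `dn - 2w` and contributes `t ^ n z ^ (2w)` to
the inverse of the denominator; the terms `1` and `z` of the numerator pick out the weights `0` and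
`1`.

Covariants are identified with seminvariants by `F ↦ F(f, e₁)`. The stabiliser of `e₁` is the
unipotent group, and `ker D₁` is its ring of invariants, `D₁` being minus the infinitesimal
generator (`D₁_eq_zero_iff`). Since `F(f, h e₁) = F(h⁻¹ f, e₁)` and the orbit of `e₁` is dense, the
leading coefficient determines `F`. Conversely, a seminvariant `s` gives a well-defined function
`F(f, h e₁) = s(h⁻¹ f)`. It is polynomial up to a power of either coordinate of the vector, and
coprimality of the two coordinates removes the denominators (`exists_eval_mulVec_e₁_eq`). -/

namespace BinaryForms

open MvPolynomial

/-! The operators `D₁` and `D₂` form an `sl₂`-pair; the dimension of the kernel of `D₁`. -/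

section SlTwo

variable {W : Type*} [AddCommGroup W] [Module ℂ W]

/-- In an `sl₂`-graded space that vanishes in large weights, `e ∘ f` has no eigenvalue `≤ 0` on
the spaces of positive weight. -/
theorem eq_zero_of_raise_lower_eq {V : ℤ → Submodule ℂ W} {e f : W →ₗ[ℂ] W}
    (he : ∀ μ, ∀ p ∈ V μ, e p ∈ V (μ + 2))
    (hef : ∀ μ, ∀ p ∈ V μ, e (f p) - f (e p) = (μ : ℂ) • p)
    {N : ℤ} (hN : ∀ μ, N < μ → V μ = ⊥) {μ : ℤ} (hμ : 0 < μ) {c : ℤ} (hc : 0 ≤ c) {p : W}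
    (hp : p ∈ V μ) (h : e (f p) = -(c : ℂ) • p) : p = 0 := by
  -- Induct on the number `k` of raisings that carry weight `μ` past the bound `N`.
  obtain ⟨k, hk⟩ : ∃ k : ℕ, N < μ + 2 * k := ⟨(N - μ).toNat + 1, by omega⟩
  induction k generalizing μ c p with
  | zero =>
    have h0 := hN μ (by simpa using hk)
    rwa [h0, Submodule.mem_bot] at hp
  | succ k ih =>
    -- Applying `e` shows that `e p`, of weight `μ + 2`, is again an eigenvector of `e ∘ f`, with `c
    -- + μ` in place of `c`. Once `e p = 0`, this identity kills `p`.
    have hfe : f (e p) = -((c + μ : ℤ) : ℂ) • p := by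
      have h1 := hef μ p hp
      rw [h, sub_eq_iff_eq_add, ← sub_eq_iff_eq_add'] at h1
      rw [← h1]
      push_cast
      module
    have hep : e p = 0 := by
      refine ih (μ := μ + 2) (by omega) (c := c + μ) (by omega) (he μ p hp) ?_ ?_
      · rw [hfe, map_smul]
      · push_cast at hk ⊢
        linarith
    rw [hep, map_zero] at hfe
    have hne : (-((c + μ : ℤ) : ℂ)) ≠ 0 := by
      rw [neg_ne_zero, Int.cast_ne_zero]
      omega
    exact (smul_eq_zero.mp hfe.symm).resolve_left hne

end SlTwo

/-! ### Derivations and weighted gradings -/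

section Grading

variable {σ M : Type*} [AddCommMonoid M] {ω : σ → M}

theorem isWeightedHomogeneous_derivation
    (D : Derivation ℂ (MvPolynomial σ ℂ) (MvPolynomial σ ℂ)) {k : M}
    (hD : ∀ i, IsWeightedHomogeneous ω (D (X i)) (ω i + k)) {p : MvPolynomial σ ℂ} {m : M}
    (hp : IsWeightedHomogeneous ω p m) : IsWeightedHomogeneous ω (D p) (m + k) := by
  classical
  have key : ∀ s : σ →₀ ℕ, ∀ r : ℂ,
      IsWeightedHomogeneous ω (D (monomial s r)) (Finsupp.weight ω s + k) := by
    intro s r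
    have hDe : D = mkDerivation ℂ fun i => D (X i) :=
      derivation_ext fun i => by rw [mkDerivation_X]
    rw [hDe, mkDerivation_monomial, smul_eq_C_mul]
    refine IsWeightedHomogeneous.C_mul ?_ r
    refine IsWeightedHomogeneous.sum _ _ _ fun i hi => ?_
    have hs : s i ≠ 0 := Finsupp.mem_support_iff.mp hi
    have hw : Finsupp.weight ω (s - Finsupp.single i 1) + (ω i + k) = Finsupp.weight ω s + k := by
      rw [← add_assoc]
      congr 1
      conv_rhs => rw [← Finsupp.sub_add_single_one_cancel hs]
      rw [map_add, Finsupp.weight_single, one_smul]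
    rw [← hw]
    exact (isWeightedHomogeneous_monomial ω _ _ rfl).mul (hD i)
  rw [p.as_sum, map_sum]
  refine IsWeightedHomogeneous.sum _ _ _ fun s hs => ?_
  rw [← hp (mem_support_iff.mp hs)]
  exact key s _

theorem derivation_weightedHomogeneousComponent [IsRightCancelAdd M]
    (D : Derivation ℂ (MvPolynomial σ ℂ) (MvPolynomial σ ℂ)) {k : M}
    (hD : ∀ i, IsWeightedHomogeneous ω (D (X i)) (ω i + k)) (p : MvPolynomial σ ℂ) (m : M) :
    D (weightedHomogeneousComponent ω m p) = weightedHomogeneousComponent ω (m + k) (D p) := by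
  classical
  induction p using MvPolynomial.induction_on' with
  | add p q hp hq => simp only [map_add, hp, hq]
  | monomial s r =>
    have h1 := isWeightedHomogeneous_monomial ω s r rfl
    have h2 := isWeightedHomogeneous_derivation D hD h1
    rw [weightedHomogeneousComponent_of_mem h1, weightedHomogeneousComponent_of_mem h2]
    simp only [add_left_inj]
    split_ifs <;> simp

theorem coeff_mkDerivation_smul_X (c : σ → ℂ) (p : MvPolynomial σ ℂ) (m : σ →₀ ℕ) :
    coeff m (mkDerivation ℂ (fun i => C (c i) * X i : σ → MvPolynomial σ ℂ) p) =
      Finsupp.weight c m * coeff m p := by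
  classical
  induction p using MvPolynomial.induction_on' with
  | add p q hp hq => simp only [map_add, coeff_add, hp, hq, mul_add]
  | monomial s r =>
    have h : mkDerivation ℂ (fun i => C (c i) * X i : σ → MvPolynomial σ ℂ) (monomial s r) =
        monomial s (Finsupp.weight c s * r) := by
      rw [mkDerivation_monomial, Finsupp.weight_apply, Finsupp.sum, Finsupp.sum, Finset.sum_mul,
        map_sum, Finset.smul_sum]
      refine Finset.sum_congr rfl fun i hi => ?_
      have hs : s i ≠ 0 := Finsupp.mem_support_iff.mp hi
      rw [X, C_mul_monomial, smul_eq_mul, monomial_mul, Finsupp.sub_add_single_one_cancel hs,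
        smul_monomial]
      congr 1
      simp
      ring
    rw [h, coeff_monomial, coeff_monomial]
    split_ifs with hm
    · rw [hm]
    · simp

end Grading

/-! ### The `sl₂`-action on polynomials of fixed degree -/

variable {d : ℕ}

/-- The pair formed by the `sl₂`-weight and the degree of the variable `vᵢ`. -/
def biweight (d : ℕ) (i : Fin (d + 1)) : ℤ × ℕ := ((d : ℤ) - 2 * (i : ℕ), 1)

theorem weight_biweight (m : Fin (d + 1) →₀ ℕ) :
    Finsupp.weight (biweight d) m =
      ((d : ℤ) * m.degree - 2 * (Finsupp.weight (fun i : Fin (d + 1) => (i : ℕ)) m : ℕ),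
        m.degree) := by
  induction m using Finsupp.induction_linear with
  | zero => simp [Prod.zero_eq_mk]
  | add f g hf hg =>
    rw [map_add, hf, hg, map_add, map_add]
    ext
    · push_cast [Prod.fst_add]; ring
    · simp
  | single i a =>
    ext
    · simp [biweight, Finsupp.weight_single]; ring
    · simp [biweight, Finsupp.weight_single]

/-- The derivation with `vᵢ ↦ (d - i) vᵢ₊₁`. -/
noncomputable def D₂ (d : ℕ) :
    Derivation ℂ (MvPolynomial (Fin (d + 1)) ℂ) (MvPolynomial (Fin (d + 1)) ℂ) :=
  mkDerivation ℂ fun i =>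
    Fin.lastCases 0 (fun j : Fin d => C ((d : ℂ) - (j : ℕ)) * X j.succ) i

@[simp] theorem D₁_X_zero : D₁ d (X 0) = 0 := by simp [D₁]

@[simp] theorem D₁_X_succ (j : Fin d) : D₁ d (X j.succ) = C ((j : ℂ) + 1) * X j.castSucc := by
  simp [D₁]

@[simp] theorem D₂_X_last : D₂ d (X (Fin.last d)) = 0 := by simp [D₂]

@[simp] theorem D₂_X_castSucc (j : Fin d) :
    D₂ d (X j.castSucc) = C ((d : ℂ) - (j : ℕ)) * X j.succ := by
  simp [D₂]

theorem isWeightedHomogeneous_D₁_X (i : Fin (d + 1)) :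
    IsWeightedHomogeneous (biweight d) (D₁ d (X i)) (biweight d i + (2, 0)) := by
  induction i using Fin.cases with
  | zero => rw [D₁_X_zero]; exact isWeightedHomogeneous_zero _ _ _
  | succ j =>
    rw [D₁_X_succ]
    have h : biweight d j.succ + (2, 0) = biweight d j.castSucc := by
      simp [biweight]; ring
    rw [h]
    exact (isWeightedHomogeneous_X _ _ _).C_mul _

theorem isWeightedHomogeneous_D₂_X (i : Fin (d + 1)) :
    IsWeightedHomogeneous (biweight d) (D₂ d (X i)) (biweight d i + (-2, 0)) := by
  induction i using Fin.lastCases with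
  | last => rw [D₂_X_last]; exact isWeightedHomogeneous_zero _ _ _
  | cast j =>
    rw [D₂_X_castSucc]
    have h : biweight d j.castSucc + (-2, 0) = biweight d j.succ := by
      simp [biweight]; ring
    rw [h]
    exact (isWeightedHomogeneous_X _ _ _).C_mul _

/-- Derivations are compared on generators, where `(d - i)(i + 1) - i(d - i + 1) = d - 2i`. -/
theorem commutator_D₁_D₂ :
    ⁅D₁ d, D₂ d⁆ = mkDerivation ℂ fun i : Fin (d + 1) => C ((d : ℂ) - 2 * (i : ℕ)) * X i := by
  refine derivation_ext fun i => ?_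
  rw [Derivation.commutator_apply, mkDerivation_X]
  have h12 : D₁ d (D₂ d (X i)) = C (((d : ℂ) - (i : ℕ)) * ((i : ℕ) + 1)) * X i := by
    induction i using Fin.lastCases with
    | last => simp
    | cast j =>
      rw [D₂_X_castSucc, C_mul', Derivation.map_smul, D₁_X_succ, ← C_mul', ← mul_assoc, ← C_mul,
        Fin.val_castSucc]
  have h21 : D₂ d (D₁ d (X i)) = C ((i : ℕ) * ((d : ℂ) - (i : ℕ) + 1)) * X i := by
    induction i using Fin.cases with
    | zero => simp
    | succ j =>
      rw [D₁_X_succ, C_mul', Derivation.map_smul, D₂_X_castSucc, ← C_mul', ← mul_assoc, ← C_mul,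
        Fin.val_succ]
      push_cast
      congr 3
      ring
  rw [h12, h21, ← sub_mul, ← C_sub]
  congr 2
  ring

/-- Polynomials of degree `n` and `sl₂`-weight `μ`. -/
noncomputable def weightSpace (d n : ℕ) (μ : ℤ) : Submodule ℂ (MvPolynomial (Fin (d + 1)) ℂ) :=
  weightedHomogeneousSubmodule ℂ (biweight d) (μ, n)

theorem D₁_mem_weightSpace {n : ℕ} {μ : ℤ} {p : MvPolynomial (Fin (d + 1)) ℂ}
    (hp : p ∈ weightSpace d n μ) : D₁ d p ∈ weightSpace d n (μ + 2) := by
  have := isWeightedHomogeneous_derivation (D₁ d) isWeightedHomogeneous_D₁_X hp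
  rwa [Prod.mk_add_mk, add_zero] at this

theorem D₂_mem_weightSpace {n : ℕ} {μ : ℤ} {p : MvPolynomial (Fin (d + 1)) ℂ}
    (hp : p ∈ weightSpace d n μ) : D₂ d p ∈ weightSpace d n (μ - 2) := by
  have := isWeightedHomogeneous_derivation (D₂ d) isWeightedHomogeneous_D₂_X hp
  rwa [Prod.mk_add_mk, add_zero] at this

theorem D₁_D₂_sub_D₂_D₁ {n : ℕ} {μ : ℤ} {p : MvPolynomial (Fin (d + 1)) ℂ}
    (hp : p ∈ weightSpace d n μ) : D₁ d (D₂ d p) - D₂ d (D₁ d p) = (μ : ℂ) • p := by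
  rw [← Derivation.commutator_apply, commutator_D₁_D₂]
  ext m
  rw [coeff_mkDerivation_smul_X, coeff_smul, smul_eq_mul]
  by_cases hm : coeff m p = 0
  · simp [hm]
  · congr 1
    have h := hp hm
    have h' : μ = (Finsupp.weight (biweight d) m).1 := by rw [h]
    rw [h', Finsupp.weight_apply, Finsupp.weight_apply, Finsupp.sum, Finsupp.sum, Prod.fst_sum]
    simp [biweight]

theorem weight_le_mul_degree (m : Fin (d + 1) →₀ ℕ) :
    Finsupp.weight (fun i : Fin (d + 1) => (i : ℕ)) m ≤ d * m.degree := by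
  rw [Finsupp.weight_apply, Finsupp.sum, Finsupp.degree_apply, Finset.mul_sum]
  refine Finset.sum_le_sum fun i _ => ?_
  rw [smul_eq_mul, mul_comm]
  exact Nat.mul_le_mul_right _ (Nat.lt_succ_iff.mp i.2)

/-- A monomial of degree `n` has weight `dn - 2w` with `0 ≤ w ≤ dn`. -/
theorem weightSpace_eq_bot {n : ℕ} {μ : ℤ} (hμ : (d : ℤ) * n < |μ|) : weightSpace d n μ = ⊥ := by
  refine (Submodule.eq_bot_iff _).mpr fun p hp => ?_
  ext m
  by_contra hm
  have h := hp hm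
  rw [weight_biweight, Prod.mk.injEq] at h
  have h2 := weight_le_mul_degree m
  obtain ⟨h1, rfl⟩ := h
  zify at h2
  rw [lt_abs] at hμ
  omega

theorem finite_setOf_degree_eq (d n : ℕ) (P : (Fin (d + 1) →₀ ℕ) → Prop) :
    {m : Fin (d + 1) →₀ ℕ | m.degree = n ∧ P m}.Finite :=
  (Finsupp.finite_of_degree_le n).subset fun _ hm => le_of_eq hm.1

theorem finite_restrictSupport {σ : Type*} {s : Set (σ →₀ ℕ)} (hs : s.Finite) :
    Module.Finite ℂ (restrictSupport ℂ s) := by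
  have := hs.to_subtype
  exact Module.Finite.of_basis (basisRestrictSupport ℂ s)

theorem finrank_restrictSupport {σ : Type*} (s : Set (σ →₀ ℕ)) :
    Module.finrank ℂ (restrictSupport ℂ s) = s.ncard := by
  rw [Module.finrank_eq_nat_card_basis (basisRestrictSupport ℂ s), Set.ncard_def, Nat.card]
  rfl

theorem weightSpace_finite (n : ℕ) (μ : ℤ) : Module.Finite ℂ (weightSpace d n μ) := by
  have h : weightSpace d n μ ≤ restrictSupport ℂ {m | m.degree = n ∧ True} := by
    intro p hp
    rw [mem_restrictSupport_iff]
    intro m hm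
    have h := hp (mem_support_iff.mp hm)
    rw [weight_biweight, Prod.mk.injEq] at h
    exact ⟨h.2, trivial⟩
  have := finite_restrictSupport (finite_setOf_degree_eq d n fun _ => True)
  exact Module.Finite.of_injective (Submodule.inclusion h) (Submodule.inclusion_injective h)

theorem eq_zero_of_D₁_eq_zero {n : ℕ} {μ : ℤ} (hμ : μ < 0) {p : MvPolynomial (Fin (d + 1)) ℂ}
    (hp : p ∈ weightSpace d n μ) (h : D₁ d p = 0) : p = 0 := by
  -- Negating weights exchanges the roles of `D₁` and `D₂`; the hypothesis is the eigenvalue `0` of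
  -- `D₂ ∘ D₁`.
  refine eq_zero_of_raise_lower_eq (V := fun ν => weightSpace d n (-ν))
    (e := (D₂ d).toLinearMap) (f := (D₁ d).toLinearMap) (μ := -μ) (c := 0)
    (fun ν q hq => ?_) (fun ν q hq => ?_) (N := d * n) (fun ν hν => ?_) (by omega) le_rfl ?_ ?_
  · have := D₂_mem_weightSpace hq
    simpa [sub_eq_add_neg, add_comm] using this
  · have := D₁_D₂_sub_D₂_D₁ hq
    simp only [Derivation.coeFn_coe]
    rw [← neg_sub, this]
    simp
  · exact weightSpace_eq_bot (by rw [abs_neg]; exact hν.trans_le (le_abs_self _))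
  · simpa using hp
  · simp [h]

/-- `D₁ ∘ D₂` is an injective endomorphism of a finite-dimensional weight space, hence surjective.
-/
theorem exists_D₁_eq {n : ℕ} {μ : ℤ} (hμ : 0 < μ) {p : MvPolynomial (Fin (d + 1)) ℂ}
    (hp : p ∈ weightSpace d n μ) : ∃ q ∈ weightSpace d n (μ - 2), D₁ d q = p := by
  have := weightSpace_finite (d := d) n μ
  let T : weightSpace d n μ →ₗ[ℂ] weightSpace d n μ :=
    ((D₁ d).toLinearMap ∘ₗ (D₂ d).toLinearMap).restrict fun q hq => by
      have := D₁_mem_weightSpace (D₂_mem_weightSpace hq)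
      rwa [sub_add_cancel] at this
  have hT : Function.Injective T := by
    refine (injective_iff_map_eq_zero T).mpr fun q hq => ?_
    have hq' : D₁ d (D₂ d q.1) = 0 := congrArg Subtype.val hq
    refine Subtype.ext (eq_zero_of_raise_lower_eq (V := weightSpace d n)
      (e := (D₁ d).toLinearMap) (f := (D₂ d).toLinearMap) (N := d * n) (c := 0)
      (fun ν q hq => D₁_mem_weightSpace hq) (fun ν q hq => D₁_D₂_sub_D₂_D₁ hq)
      (fun ν hν => weightSpace_eq_bot (hν.trans_le (le_abs_self _))) hμ le_rfl q.2 ?_)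
    simp [hq']
  obtain ⟨q, hq⟩ := LinearMap.surjective_of_injective hT ⟨p, hp⟩
  exact ⟨D₂ d q.1, D₂_mem_weightSpace q.2, congrArg Subtype.val hq⟩

/-! ### The dimension of the space of seminvariants -/

/-- The exponents of degree `n` whose `sl₂`-weight satisfies `P`. -/
def exponents (d n : ℕ) (P : ℤ → Prop) : Set (Fin (d + 1) →₀ ℕ) :=
  {m | m.degree = n ∧ P (Finsupp.weight (biweight d) m).1}

theorem weightSpace_le_restrictSupport {n : ℕ} {μ : ℤ} {P : ℤ → Prop} (hμ : P μ) :
    weightSpace d n μ ≤ restrictSupport ℂ (exponents d n P) := by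
  intro p hp
  rw [mem_restrictSupport_iff]
  intro m hm
  have h := hp (mem_support_iff.mp hm)
  have h' := h
  rw [weight_biweight, Prod.mk.injEq] at h
  exact ⟨h.2, by rw [h']; exact hμ⟩

theorem monomial_mem_weightSpace (m : Fin (d + 1) →₀ ℕ) (r : ℂ) :
    monomial m r ∈ weightSpace d m.degree (Finsupp.weight (biweight d) m).1 :=
  isWeightedHomogeneous_monomial _ _ _ (by rw [weight_biweight])

theorem map_D₁_restrictSupport (n : ℕ) :
    (restrictSupport ℂ (exponents d n (0 ≤ ·))).map (D₁ d).toLinearMap =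
      restrictSupport ℂ (exponents d n (2 ≤ ·)) := by
  refine le_antisymm ?_ ?_
  · rw [restrictSupport_eq_span, Submodule.map_span_le]
    rintro _ ⟨m, ⟨rfl, hm⟩, rfl⟩
    exact weightSpace_le_restrictSupport (P := (2 ≤ ·)) (by simpa using hm)
      (D₁_mem_weightSpace (monomial_mem_weightSpace m 1))
  · rw [restrictSupport_eq_span, Submodule.span_le]
    rintro _ ⟨m, ⟨rfl, hm⟩, rfl⟩
    obtain ⟨q, hq, h⟩ := exists_D₁_eq (lt_of_lt_of_le two_pos hm) (monomial_mem_weightSpace m 1)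
    exact ⟨q, weightSpace_le_restrictSupport (P := (0 ≤ ·)) (by simpa using hm) hq, h⟩

theorem seminvariantsOfDegree_eq (n : ℕ) :
    seminvariantsOfDegree d n =
      LinearMap.ker (D₁ d).toLinearMap ⊓ restrictSupport ℂ (exponents d n (0 ≤ ·)) := by
  refine Submodule.ext fun p => ?_
  refine and_congr_right fun h0 => ⟨fun hp => ?_, fun hp m hm => ?_⟩
  · rw [SetLike.mem_coe, mem_restrictSupport_iff]
    intro m hm
    have hm' := mem_support_iff.mp hm
    have hdeg : m.degree = n := by
      rw [Finsupp.degree_eq_weight_one]; exact hp hm'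
    refine ⟨hdeg, ?_⟩
    by_contra hneg
    have h0' : D₁ d p = 0 := h0
    -- `ker D₁` is graded, so the component of `p` at a negative weight is itself in the kernel and
    -- must vanish.
    have hc := derivation_weightedHomogeneousComponent (D₁ d) isWeightedHomogeneous_D₁_X p
      (Finsupp.weight (biweight d) m)
    rw [h0', map_zero] at hc
    have hz : weightedHomogeneousComponent (biweight d) (Finsupp.weight (biweight d) m) p = 0 :=
      eq_zero_of_D₁_eq_zero (n := n) (not_le.mp hneg)
        (by
          have := weightedHomogeneousComponent_mem (biweight d) p (Finsupp.weight (biweight d) m)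
          have he : ((Finsupp.weight (biweight d) m).1, n) = Finsupp.weight (biweight d) m := by
            rw [weight_biweight, hdeg]
          rwa [weightSpace, he]) hc
    have := congrArg (coeff m) hz
    classical
    rw [coeff_weightedHomogeneousComponent, if_pos rfl, coeff_zero] at this
    exact hm' this
  · have := ((mem_restrictSupport_iff ℂ).mp hp (mem_support_iff.mpr hm)).1
    rwa [Finsupp.degree_eq_weight_one] at this

theorem exponents_finite (n : ℕ) (P : ℤ → Prop) : (exponents d n P).Finite :=
  finite_setOf_degree_eq d n _

theorem seminvariantsOfDegree_finite (n : ℕ) :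
    Module.Finite ℂ (seminvariantsOfDegree d n) := by
  have := finite_restrictSupport (exponents_finite (d := d) n (0 ≤ ·))
  have h : seminvariantsOfDegree d n ≤ restrictSupport ℂ (exponents d n (0 ≤ ·)) := by
    rw [seminvariantsOfDegree_eq]; exact inf_le_right
  exact Module.Finite.of_injective (Submodule.inclusion h) (Submodule.inclusion_injective h)

/-- Rank-nullity for `D₁` on weights `≥ 0`, whose image is everything of weight `≥ 2`. -/
theorem finrank_seminvariantsOfDegree (n : ℕ) :
    Module.finrank ℂ (seminvariantsOfDegree d n) =
      (exponents d n fun μ => 0 ≤ μ ∧ μ < 2).ncard := by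
  have := finite_restrictSupport (exponents_finite (d := d) n (0 ≤ ·))
  set U := restrictSupport ℂ (exponents d n (0 ≤ ·))
  have h := LinearMap.finrank_range_add_finrank_ker ((D₁ d).toLinearMap.domRestrict U)
  rw [LinearMap.range_domRestrict, map_D₁_restrictSupport, finrank_restrictSupport,
    finrank_restrictSupport, LinearMap.ker_domRestrict] at h
  have hk : Module.finrank ℂ ((LinearMap.ker (D₁ d).toLinearMap).comap U.subtype) =
      Module.finrank ℂ (seminvariantsOfDegree d n) := by
    rw [seminvariantsOfDegree_eq, ← Submodule.finrank_map_subtype_eq, Submodule.map_comap_subtype,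
      inf_comm]
  have hs : exponents d n (0 ≤ ·) =
      exponents d n (2 ≤ ·) ∪ exponents d n fun μ => 0 ≤ μ ∧ μ < 2 := by
    ext m
    simp only [exponents, Set.mem_union, Set.mem_ofPred_eq]
    omega
  have hd : Disjoint (exponents d n (2 ≤ ·)) (exponents d n fun μ => 0 ≤ μ ∧ μ < 2) := by
    refine Set.disjoint_left.mpr fun m h1 h2 => ?_
    exact absurd h2.2.2 (not_lt.mpr h1.2)
  have hcard := Set.ncard_union_eq hd (exponents_finite n _) (exponents_finite n _)
  rw [← hs] at hcard
  omega

/-! The coefficients of the generating function. -/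

section GeneratingFunction

variable {σ τ : Type*}

/-- The power series counting the exponents supported in `s` by their weight. -/
noncomputable def weightSeries (φ : σ → τ →₀ ℕ) (s : Finset σ) : MvPowerSeries τ ℂ :=
  fun e => ({m : σ →₀ ℕ | m.support ⊆ s ∧ Finsupp.weight φ m = e}.ncard : ℂ)

theorem coeff_weightSeries (φ : σ → τ →₀ ℕ) (s : Finset σ) (e : τ →₀ ℕ) :
    MvPowerSeries.coeff e (weightSeries φ s) =
      ({m : σ →₀ ℕ | m.support ⊆ s ∧ Finsupp.weight φ m = e}.ncard : ℂ) :=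
  rfl

theorem weightSeries_empty (φ : σ → τ →₀ ℕ) : weightSeries φ ∅ = 1 := by
  classical
  ext e
  rw [coeff_weightSeries, MvPowerSeries.coeff_one]
  split_ifs with he
  · have : {m : σ →₀ ℕ | m.support ⊆ ∅ ∧ Finsupp.weight φ m = e} = {0} := by
      ext m
      simp only [Finset.subset_empty, Finsupp.support_eq_empty, Set.mem_ofPred_eq,
        Set.mem_singleton_iff]
      exact ⟨fun h => h.1, fun h => ⟨h, by rw [h, map_zero, he]⟩⟩
    rw [this, Set.ncard_singleton, Nat.cast_one]
  · have : {m : σ →₀ ℕ | m.support ⊆ ∅ ∧ Finsupp.weight φ m = e} = ∅ := by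
      ext m
      simp only [Finset.subset_empty, Finsupp.support_eq_empty, Set.mem_ofPred_eq,
        Set.mem_empty_iff_false, iff_false]
      rintro ⟨rfl, h⟩
      exact he (by rw [← h, map_zero])
    rw [this, Set.ncard_empty, Nat.cast_zero]

/-- Multiplying by the monomial of `φ k` shifts exponents by one unit of `k`, so the subtraction
removes exactly those with `m k ≠ 0`. Finiteness matters because `ncard` of an infinite set is `0`.
-/
theorem weightSeries_insert_mul [DecidableEq σ] {φ : σ → τ →₀ ℕ} {s : Finset σ} {k : σ}
    (hk : k ∉ s)
    (hfin : ∀ e, {m : σ →₀ ℕ | m.support ⊆ insert k s ∧ Finsupp.weight φ m = e}.Finite) :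
    weightSeries φ (insert k s) * (1 - MvPowerSeries.monomial (φ k) 1) = weightSeries φ s := by
  classical
  ext e
  rw [mul_sub, mul_one, map_sub, MvPowerSeries.coeff_mul_monomial, sub_eq_iff_eq_add]
  set A := {m : σ →₀ ℕ | m.support ⊆ insert k s ∧ Finsupp.weight φ m = e}
  set B := {m : σ →₀ ℕ | m.support ⊆ s ∧ Finsupp.weight φ m = e}
  have hAB : A = B ∪ {m ∈ A | m k ≠ 0} := by
    ext m
    simp only [A, B, Set.mem_union, Set.mem_ofPred_eq]
    constructor
    · rintro ⟨h1, h2⟩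
      by_cases h0 : m k = 0
      · exact Or.inl ⟨(Finset.subset_insert_iff_of_notMem
          (by simpa using h0)).mp h1, h2⟩
      · exact Or.inr ⟨⟨h1, h2⟩, h0⟩
    · rintro (⟨h1, h2⟩ | h)
      · exact ⟨h1.trans (Finset.subset_insert _ _), h2⟩
      · exact h.1
  have hdisj : Disjoint B {m ∈ A | m k ≠ 0} := by
    refine Set.disjoint_left.mpr fun m h1 h2 => hk (h1.1 ?_)
    exact Finsupp.mem_support_iff.mpr h2.2
  have hcard : A.ncard = B.ncard + {m ∈ A | m k ≠ 0}.ncard := by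
    have hA : A.Finite := hfin e
    rw [← Set.ncard_union_eq hdisj (hA.subset (by rw [hAB]; exact Set.subset_union_left))
      (hA.subset (Set.sep_subset _ _)), ← hAB]
  rw [coeff_weightSeries, coeff_weightSeries, hcard, Nat.cast_add]
  congr 1
  split_ifs with hle
  · rw [mul_one, coeff_weightSeries]
    congr 1
    have himg : {m ∈ A | m k ≠ 0} = (fun m => m + Finsupp.single k 1) ''
        {m : σ →₀ ℕ | m.support ⊆ insert k s ∧ Finsupp.weight φ m = e - φ k} := by
      ext m
      simp only [A, Set.mem_ofPred_eq, Set.mem_image]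
      constructor
      · rintro ⟨⟨h1, h2⟩, h0⟩
        refine ⟨m - Finsupp.single k 1, ⟨?_, ?_⟩, Finsupp.sub_add_single_one_cancel h0⟩
        · exact Finsupp.support_tsub.trans h1
        · have h3 := congrArg (Finsupp.weight φ) (Finsupp.sub_add_single_one_cancel h0)
          rw [map_add, Finsupp.weight_single, one_smul, h2] at h3
          rw [← h3, add_tsub_cancel_right]
      · rintro ⟨m, ⟨h1, h2⟩, rfl⟩
        refine ⟨⟨?_, ?_⟩, by simp⟩
        · refine Finsupp.support_add.trans (Finset.union_subset h1 ?_)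
          exact Finsupp.support_single_subset.trans (by simp)
        · rw [map_add, Finsupp.weight_single, one_smul, h2, tsub_add_cancel_of_le hle]
    rw [himg, Set.ncard_image_of_injective _ (add_left_injective _)]
  · have : {m ∈ A | m k ≠ 0} = ∅ := by
      refine Set.eq_empty_of_forall_notMem fun m hm => hle ?_
      have h3 := congrArg (Finsupp.weight φ) (Finsupp.sub_add_single_one_cancel hm.2)
      rw [map_add, Finsupp.weight_single, one_smul, hm.1.2] at h3
      rw [← h3]
      exact le_add_self
    rw [this, Set.ncard_empty, Nat.cast_zero]

theorem weightSeries_mul_prod {φ : σ → τ →₀ ℕ} (s : Finset σ)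
    (hfin : ∀ t ⊆ s, ∀ e, {m : σ →₀ ℕ | m.support ⊆ t ∧ Finsupp.weight φ m = e}.Finite) :
    weightSeries φ s * ∏ k ∈ s, (1 - MvPowerSeries.monomial (φ k) 1) = 1 := by
  classical
  induction s using Finset.induction_on with
  | empty => rw [weightSeries_empty, Finset.prod_empty, mul_one]
  | insert k s hk ih =>
    rw [Finset.prod_insert hk, ← mul_assoc, weightSeries_insert_mul hk (hfin _ subset_rfl)]
    exact ih fun t ht => hfin t (ht.trans (Finset.subset_insert _ _))

end GeneratingFunction

/-- The exponent of `t z ^ (2 k)`. -/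
noncomputable def denomExponent (d : ℕ) (k : Fin (d + 1)) : Fin 2 →₀ ℕ :=
  Finsupp.single 0 1 + Finsupp.single 1 (2 * (k : ℕ))

theorem weight_denomExponent (m : Fin (d + 1) →₀ ℕ) :
    Finsupp.weight (denomExponent d) m = Finsupp.single 0 m.degree +
      Finsupp.single 1 (2 * Finsupp.weight (fun i : Fin (d + 1) => (i : ℕ)) m) := by
  induction m using Finsupp.induction_linear with
  | zero => simp
  | add f g hf hg =>
    rw [map_add, hf, hg, map_add, map_add, mul_add, Finsupp.single_add, Finsupp.single_add]
    abel
  | single i a =>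
    simp only [denomExponent, Finsupp.weight_single, Finsupp.degree_single, smul_add,
      Finsupp.smul_single, smul_eq_mul, mul_one]
    congr 2
    ring

theorem weight_denomExponent_eq_iff (m : Fin (d + 1) →₀ ℕ) (a b : ℕ) :
    Finsupp.weight (denomExponent d) m = Finsupp.single 0 a + Finsupp.single 1 b ↔
      m.degree = a ∧ 2 * Finsupp.weight (fun i : Fin (d + 1) => (i : ℕ)) m = b := by
  rw [weight_denomExponent]
  constructor
  · intro h
    exact ⟨by simpa using DFunLike.congr_fun h 0, by simpa using DFunLike.congr_fun h 1⟩
  · rintro ⟨rfl, rfl⟩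
    rfl

theorem genSeries_eq (d : ℕ) :
    genSeries d = (1 + MvPowerSeries.X 1) * weightSeries (denomExponent d) Finset.univ := by
  rw [genSeries]
  congr 1
  symm
  rw [MvPowerSeries.eq_inv_iff_mul_eq_one]
  · have h := weightSeries_mul_prod (φ := denomExponent d) Finset.univ fun t _ e => by
      -- The exponent of `t` is the degree, so only finitely many exponents have a given weight.
      refine (finite_setOf_degree_eq d (e 0) fun _ => True).subset ?_
      rintro m ⟨-, hm⟩
      rw [weight_denomExponent] at hm
      exact ⟨by simpa using DFunLike.congr_fun hm 0, trivial⟩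
    refine Eq.trans ?_ h
    rw [Finset.prod_range]
    congr 1
    refine Finset.prod_congr rfl fun k _ => ?_
    rw [MvPowerSeries.X_def, MvPowerSeries.X_pow_eq, MvPowerSeries.monomial_mul_monomial, one_mul]
    rfl
  · rw [map_prod, Finset.prod_ne_zero_iff]
    intro k _
    simp

theorem diagCoeff_genSeries (n : ℕ) :
    diagCoeff d n (genSeries d) = ((exponents d n fun μ => 0 ≤ μ ∧ μ < 2).ncard : ℂ) := by
  have hfin := exponents_finite (d := d) n
  have h0 : MvPowerSeries.coeff (Finsupp.single 0 n + Finsupp.single 1 (d * n))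
      (weightSeries (denomExponent d) Finset.univ) = ((exponents d n fun μ => μ = 0).ncard : ℂ) := by
    rw [coeff_weightSeries]
    congr 2
    ext m
    simp only [Finset.subset_univ, true_and, weight_denomExponent_eq_iff, exponents,
      weight_biweight, Set.mem_ofPred_eq]
    refine and_congr_right ?_
    rintro rfl
    zify
    omega
  have h1 : MvPowerSeries.coeff (Finsupp.single 0 n + Finsupp.single 1 (d * n))
      (MvPowerSeries.X 1 * weightSeries (denomExponent d) Finset.univ) =
        ((exponents d n fun μ => μ = 1).ncard : ℂ) := by
    rw [MvPowerSeries.X_def, MvPowerSeries.coeff_monomial_mul, one_mul]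
    split_ifs with hle
    · have hpos : 1 ≤ d * n := by simpa using hle 1
      have he : Finsupp.single 0 n + Finsupp.single 1 (d * n) - Finsupp.single 1 1 =
          (Finsupp.single 0 n + Finsupp.single 1 (d * n - 1) : Fin 2 →₀ ℕ) := by
        ext i
        fin_cases i <;> simp
      rw [he, coeff_weightSeries]
      congr 2
      ext m
      simp only [Finset.subset_univ, true_and, weight_denomExponent_eq_iff, exponents,
        weight_biweight, Set.mem_ofPred_eq]
      refine and_congr_right ?_
      rintro rfl
      zify [hpos]
      omega
    -- Here `d * n = 0`, and weight `1` would force `d * n ≥ 1`.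
    · have : exponents d n (fun μ => μ = 1) = ∅ := by
        refine Set.eq_empty_of_forall_notMem fun m hm => hle ?_
        obtain ⟨rfl, hm⟩ := hm
        rw [weight_biweight] at hm
        have : 1 ≤ d * m.degree := by
          zify
          simp only at hm
          omega
        intro i
        fin_cases i <;> simp
        exact this
      rw [this, Set.ncard_empty, Nat.cast_zero]
  rw [diagCoeff, genSeries_eq, add_mul, one_mul, map_add, h0, h1, ← Nat.cast_add,
    ← Set.ncard_union_eq _ (hfin _) (hfin _)]
  · congr 2
    ext m
    simp only [exponents, Set.mem_union, Set.mem_ofPred_eq]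
    omega
  · refine Set.disjoint_left.mpr fun m h1 h2 => ?_
    have := h1.2.symm.trans h2.2
    omega

/-! The action on coefficient vectors. -/

section Action

local notation "SL2" => Matrix.SpecialLinearGroup (Fin 2) ℂ

theorem eval_transform (g : SL2) (f : MvPolynomial (Fin 2) ℂ) (v : Fin 2 → ℂ) :
    eval v (transform g f) = eval (g⁻¹.val.mulVec v) f := by
  rw [transform, ← coe_aeval_eq_eval, ← coe_aeval_eq_eval]
  simp only [RingHom.coe_coe, aeval_bind₁]
  congr 2
  ext i
  simp [Matrix.mulVec, dotProduct]

theorem transform_transform (g h : SL2) (f : MvPolynomial (Fin 2) ℂ) :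
    transform g (transform h f) = transform (g * h) f := by
  refine MvPolynomial.funext fun v => ?_
  rw [eval_transform, eval_transform, eval_transform, Matrix.mulVec_mulVec, mul_inv_rev,
    Matrix.SpecialLinearGroup.coe_mul]

theorem isHomogeneous_transform (g : SL2) {f : MvPolynomial (Fin 2) ℂ} (hf : f.IsHomogeneous d) :
    (transform g f).IsHomogeneous d := by
  rw [← one_mul d]
  exact hf.aeval _ fun i => IsHomogeneous.sum _ _ _ fun j _ => isHomogeneous_C_mul_X _ _

theorem isHomogeneous_form (a : Fin (d + 1) → ℂ) : (form d a).IsHomogeneous d := by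
  refine IsHomogeneous.sum _ _ _ fun i _ => ?_
  have h := ((isHomogeneous_C (Fin 2) ((d.choose i : ℂ) * a i)).mul
    (isHomogeneous_X_pow (R := ℂ) (0 : Fin 2) (d - (i : ℕ)))).mul
    (isHomogeneous_X_pow (R := ℂ) (1 : Fin 2) (i : ℕ))
  rwa [zero_add, Nat.sub_add_cancel (Nat.lt_succ_iff.mp i.2)] at h

theorem form_eq_sum_monomial (a : Fin (d + 1) → ℂ) :
    form d a = ∑ i : Fin (d + 1),
      monomial (Finsupp.single 0 (d - (i : ℕ)) + Finsupp.single 1 (i : ℕ))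
        ((d.choose i : ℂ) * a i) := by
  refine Finset.sum_congr rfl fun i _ => ?_
  rw [X_pow_eq_monomial, X_pow_eq_monomial, C_mul_monomial, monomial_mul, mul_one, mul_one]

theorem single_add_single_eq_iff {a b i j : ℕ} :
    (Finsupp.single 0 a + Finsupp.single 1 i : Fin 2 →₀ ℕ) =
      Finsupp.single 0 b + Finsupp.single 1 j ↔ a = b ∧ i = j := by
  constructor
  · intro h
    exact ⟨by simpa using DFunLike.congr_fun h 0, by simpa using DFunLike.congr_fun h 1⟩
  · rintro ⟨rfl, rfl⟩
    rfl

theorem choose_cast_ne_zero (i : Fin (d + 1)) : (d.choose i : ℂ) ≠ 0 :=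
  Nat.cast_ne_zero.mpr (Nat.choose_pos (Nat.lt_succ_iff.mp i.2)).ne'

theorem coord_form (a : Fin (d + 1) → ℂ) : coord d (form d a) = a := by
  ext i
  rw [coord, form_eq_sum_monomial, coeff_sum, Finset.sum_eq_single i]
  · rw [coeff_monomial, if_pos rfl, mul_div_cancel_left₀ _ (choose_cast_ne_zero i)]
  · intro j _ hj
    rw [coeff_monomial, if_neg]
    rw [single_add_single_eq_iff]
    exact fun h => hj (Fin.ext h.2)
  · exact fun h => absurd (Finset.mem_univ i) h

theorem form_coord {f : MvPolynomial (Fin 2) ℂ} (hf : f.IsHomogeneous d) :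
    form d (coord d f) = f := by
  ext m
  by_cases hm : m.degree = d
  · obtain ⟨i, rfl⟩ : ∃ i : Fin (d + 1),
        m = Finsupp.single 0 (d - (i : ℕ)) + Finsupp.single 1 (i : ℕ) := by
      rw [Finsupp.degree_eq_sum, Fin.sum_univ_two] at hm
      refine ⟨⟨m 1, by omega⟩, ?_⟩
      ext j
      fin_cases j
      · simp; omega
      · simp
    have h := congrFun (coord_form (coord d f)) i
    rw [coord, coord, div_left_inj' (choose_cast_ne_zero i)] at h
    exact h
  · rw [(isHomogeneous_form _).coeff_eq_zero hm, hf.coeff_eq_zero hm]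

theorem act_act (g h : SL2) (a : Fin (d + 1) → ℂ) : act d g (act d h a) = act d (g * h) a := by
  rw [act, act, form_coord (isHomogeneous_transform h (isHomogeneous_form a)),
    transform_transform, act]

theorem act_one (a : Fin (d + 1) → ℂ) : act d 1 a = a := by
  have h : transform 1 (form d a) = form d a :=
    MvPolynomial.funext fun v => by rw [eval_transform]; simp
  rw [act, h, coord_form]

theorem act_act_inv (g : SL2) (a : Fin (d + 1) → ℂ) : act d g (act d g⁻¹ a) = a := by
  rw [act_act, mul_inv_cancel, act_one]

theorem act_smul (g : SL2) (c : ℂ) (a : Fin (d + 1) → ℂ) :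
    act d g (c • a) = c • act d g a := by
  have h : form d (c • a) = c • form d a := by
    rw [form, form, Finset.smul_sum]
    refine Finset.sum_congr rfl fun i _ => ?_
    simp [smul_eq_C_mul]
    ring
  ext i
  rw [act, act, h, map_smul, coord, coeff_smul, Pi.smul_apply, coord, smul_eq_mul, smul_eq_mul,
    mul_div_assoc]

/-- The coefficients of `g • f` are polynomial functions of those of `f` and the entries
of `g⁻¹`. -/
theorem exists_eval_eq_act (i : Fin (d + 1)) :
    ∃ Q : MvPolynomial (Fin (d + 1) ⊕ Fin 2 × Fin 2) ℂ, ∀ (g : SL2) (a : Fin (d + 1) → ℂ),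
      act d g a i = eval (Sum.elim a fun p => g⁻¹.val p.1 p.2) Q := by
  -- The universal transformed form: the coefficients and the entries of `g⁻¹` become
  -- indeterminates, and `hG` specialises them.
  let l : Fin 2 → MvPolynomial (Fin 2) (MvPolynomial (Fin (d + 1) ⊕ Fin 2 × Fin 2) ℂ) :=
    fun r => ∑ j : Fin 2, C (X (Sum.inr (r, j))) * X j
  let G : MvPolynomial (Fin 2) (MvPolynomial (Fin (d + 1) ⊕ Fin 2 × Fin 2) ℂ) :=
    ∑ k : Fin (d + 1), C (C (d.choose k : ℂ) * X (Sum.inl k)) *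
      l 0 ^ (d - (k : ℕ)) * l 1 ^ (k : ℕ)
  refine ⟨C ((d.choose i : ℂ)⁻¹) *
    coeff (Finsupp.single 0 (d - (i : ℕ)) + Finsupp.single 1 (i : ℕ)) G, fun g a => ?_⟩
  have hG : map (eval (Sum.elim a fun p => g⁻¹.val p.1 p.2)) G = transform g (form d a) := by
    simp only [G, l, form, transform, map_sum, map_mul, map_pow, map_C, map_X, eval_C, eval_X,
      Sum.elim_inl, Sum.elim_inr, bind₁_X_right, algHom_C, algebraMap_eq]
  rw [map_mul, eval_C, ← coeff_map, hG, act, coord, div_eq_inv_mul]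

theorem exists_eval_eq_eval_act (s : MvPolynomial (Fin (d + 1)) ℂ) :
    ∃ T : MvPolynomial (Fin (d + 1) ⊕ Fin 2 × Fin 2) ℂ, ∀ (g : SL2) (a : Fin (d + 1) → ℂ),
      eval (act d g a) s = eval (Sum.elim a fun p => g⁻¹.val p.1 p.2) T := by
  choose Q hQ using exists_eval_eq_act (d := d)
  refine ⟨bind₁ Q s, fun g a => ?_⟩
  rw [← coe_aeval_eq_eval, ← coe_aeval_eq_eval, RingHom.coe_coe, RingHom.coe_coe, aeval_bind₁]
  congr 2
  ext i
  rw [hQ i g a, ← coe_aeval_eq_eval, RingHom.coe_coe]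

/-! The unipotent subgroup and the derivation `D₁`. -/

/-- The matrix `(1 t; 0 1)`. -/
def unipotent (t : ℂ) : SL2 := ⟨!![1, t; 0, 1], by simp [Matrix.det_fin_two]⟩

theorem coeff_add_C_mul_X_pow_mul (r : ℂ) (d : ℕ) {i k : ℕ} (hi : i ≤ d) (hk : k ≤ d) :
    coeff (Finsupp.single 0 (d - i) + Finsupp.single 1 i)
      ((X 0 + C r * X 1) ^ (d - k) * X 1 ^ k : MvPolynomial (Fin 2) ℂ) =
        if k ≤ i then ((d - k).choose (i - k) : ℂ) * r ^ (i - k) else 0 := by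
  have h : ((X 0 + C r * X 1) ^ (d - k) * X 1 ^ k : MvPolynomial (Fin 2) ℂ) =
      ∑ m ∈ Finset.range (d - k + 1),
        monomial (Finsupp.single 0 (d - k - m) + Finsupp.single 1 (m + k))
          (((d - k).choose m : ℂ) * r ^ m) := by
    rw [add_comm, add_pow, Finset.sum_mul]
    refine Finset.sum_congr rfl fun m _ => ?_
    rw [mul_pow, ← C_pow, X_pow_eq_monomial, X_pow_eq_monomial, X_pow_eq_monomial,
      ← map_natCast (C : ℂ →+* MvPolynomial (Fin 2) ℂ), mul_comm _ (C _), ← mul_assoc,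
      ← mul_assoc, ← C_mul, C_mul_monomial, monomial_mul, monomial_mul, Finsupp.single_add]
    simp only [mul_one]
    rw [← add_assoc, add_comm (Finsupp.single 1 m)]
  rw [h, coeff_sum]
  simp only [coeff_monomial, single_add_single_eq_iff]
  split_ifs with hki
  · rw [Finset.sum_eq_single (i - k), if_pos (by omega)]
    · intro m _ hm
      rw [if_neg (by omega)]
    · intro hm
      rw [Finset.mem_range] at hm
      omega
  · refine Finset.sum_eq_zero fun m _ => if_neg (by omega)

/-- The inverse matrix substitutes `x - t y` for `x`; the binomials combine by `C(d,i) C(i,k) =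
C(d,k) C(d-k,i-k)`. For `k > i` the binomial vanishes, so the truncated exponent is harmless. -/
theorem act_unipotent (t : ℂ) (a : Fin (d + 1) → ℂ) (i : Fin (d + 1)) :
    act d (unipotent t) a i =
      ∑ k : Fin (d + 1), ((i : ℕ).choose k : ℂ) * (-t) ^ ((i : ℕ) - (k : ℕ)) * a k := by
  have hinv : ((unipotent t)⁻¹ : SL2).val = !![1, -t; 0, 1] := by
    rw [Matrix.SpecialLinearGroup.coe_inv, unipotent, Matrix.adjugate_fin_two]
    simp
  have h : transform (unipotent t) (form d a) = ∑ k : Fin (d + 1), C ((d.choose k : ℂ) * a k) *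
      ((X 0 + C (-t) * X 1) ^ (d - (k : ℕ)) * X 1 ^ (k : ℕ)) := by
    simp only [form, transform, map_sum, map_mul (bind₁ _), map_pow, bind₁_X_right, hinv]
    simp [Fin.sum_univ_two, mul_assoc]
  rw [act, h, coord, coeff_sum, Finset.sum_div]
  refine Finset.sum_congr rfl fun k _ => ?_
  rw [coeff_C_mul, coeff_add_C_mul_X_pow_mul _ _ (Nat.lt_succ_iff.mp i.2)
    (Nat.lt_succ_iff.mp k.2), div_eq_iff (choose_cast_ne_zero i)]
  split_ifs with hki
  · have := Nat.choose_mul (n := d) hki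
    have h' : (d.choose i : ℂ) * ((i : ℕ).choose k : ℂ) =
        d.choose k * (d - k : ℕ).choose ((i : ℕ) - k) := by exact_mod_cast this
    linear_combination (-(a k) * (-t) ^ ((i : ℕ) - (k : ℕ))) * h'
  · rw [Nat.choose_eq_zero_of_lt (not_le.mp hki)]
    simp

theorem hasDerivAt_act_unipotent (a : Fin (d + 1) → ℂ) (i : Fin (d + 1)) (t : ℂ) :
    HasDerivAt (fun t => act d (unipotent t) a i)
      (-eval (act d (unipotent t) a) (D₁ d (X i))) t := by
  simp only [act_unipotent]
  have h : HasDerivAt (fun t : ℂ => ∑ k : Fin (d + 1),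
      ((i : ℕ).choose k : ℂ) * (-t) ^ ((i : ℕ) - (k : ℕ)) * a k)
      (∑ k : Fin (d + 1), ((i : ℕ).choose k : ℂ) *
        (((i : ℕ) - (k : ℕ) : ℕ) * (-t) ^ ((i : ℕ) - (k : ℕ) - 1) * -1) * a k) t :=
    HasDerivAt.fun_sum fun k _ =>
      ((((hasDerivAt_id t).neg).pow ((i : ℕ) - (k : ℕ))).const_mul _).mul_const _
  convert h using 1
  induction i using Fin.cases with
  | zero => simp
  | succ j =>
    rw [D₁_X_succ, map_mul, eval_C, eval_X, act_unipotent, Finset.mul_sum,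
      ← Finset.sum_neg_distrib]
    refine Finset.sum_congr rfl fun k _ => ?_
    have h1 := Nat.choose_mul_succ_eq (j : ℕ) (k : ℕ)
    have h2 : (((j : ℕ).choose k : ℂ)) * ((j : ℕ) + 1) =
        ((j : ℕ) + 1).choose k * ((j : ℕ) + 1 - k : ℕ) := by exact_mod_cast h1
    have h3 : (j : ℕ) + 1 - (k : ℕ) - 1 = (j : ℕ) - k := by omega
    rw [Fin.val_succ, Fin.val_castSucc, h3]
    linear_combination (-(-t) ^ ((j : ℕ) - (k : ℕ)) * a k) * h2

theorem hasDerivAt_eval_act_unipotent (s : MvPolynomial (Fin (d + 1)) ℂ) (a : Fin (d + 1) → ℂ)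
    (t : ℂ) :
    HasDerivAt (fun t => eval (act d (unipotent t) a) s)
      (-eval (act d (unipotent t) a) (D₁ d s)) t := by
  induction s using MvPolynomial.induction_on with
  | C r => simpa [← algebraMap_eq] using hasDerivAt_const t r
  | add p q hp hq =>
    simp only [map_add]
    rw [neg_add]
    exact hp.fun_add hq
  | mul_X p i hp =>
    simp only [map_mul, eval_X]
    refine (hp.fun_mul (hasDerivAt_act_unipotent a i t)).congr_deriv ?_
    rw [Derivation.leibniz]
    simp only [smul_eq_mul, map_add, map_mul, eval_X]
    ring

/-- Along `t ↦ unipotent t`, the derivative of `s` is `-D₁ s` at the moved point. If this is zero,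
`s` is constant on each orbit; conversely, differentiate the constant function at `t = 0`. -/
theorem D₁_eq_zero_iff (s : MvPolynomial (Fin (d + 1)) ℂ) :
    D₁ d s = 0 ↔ ∀ t a, eval (act d (unipotent t) a) s = eval a s := by
  have h1 : unipotent 0 = 1 := by
    ext i j
    fin_cases i <;> fin_cases j <;> simp [unipotent]
  constructor
  · intro hs t a
    have hd : ∀ t, HasDerivAt (fun t => eval (act d (unipotent t) a) s) 0 t := fun t => by
      simpa [hs] using hasDerivAt_eval_act_unipotent s a t
    have := is_const_of_deriv_eq_zero (fun t => (hd t).differentiableAt)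
      (fun t => (hd t).deriv) t 0
    simpa only [h1, act_one] using this
  · intro hs
    refine MvPolynomial.funext fun a => ?_
    have h := hasDerivAt_eval_act_unipotent s a 0
    simp only [hs] at h
    have h' := h.unique (hasDerivAt_const 0 _)
    rw [h1, act_one, neg_eq_zero] at h'
    rw [h', map_zero]

/-! Homogeneity and scaling. -/

theorem coeff_aeval_C_pow_mul_X {σ : Type*} (ω : σ → ℕ) (c : ℂ) (p : MvPolynomial σ ℂ)
    (m : σ →₀ ℕ) :
    coeff m (aeval (fun i => C (c ^ ω i) * X i : σ → MvPolynomial σ ℂ) p) =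
      c ^ Finsupp.weight ω m * coeff m p := by
  classical
  induction p using MvPolynomial.induction_on' with
  | add p q hp hq => simp only [map_add, coeff_add, hp, hq, mul_add]
  | monomial s r =>
    have h : aeval (fun i => C (c ^ ω i) * X i : σ → MvPolynomial σ ℂ) (monomial s r) =
        monomial s (c ^ Finsupp.weight ω s * r) := by
      rw [aeval_monomial, Finsupp.weight_apply, Finsupp.prod, Finsupp.sum]
      simp only [mul_pow]
      rw [Finset.prod_mul_distrib, ← Finset.prod_pow_eq_pow_sum, mul_comm _ r,
        monomial_eq (a := r * _), C_mul, algebraMap_eq, map_prod, mul_assoc, Finsupp.prod]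
      congr 2
      refine Finset.prod_congr rfl fun i _ => ?_
      rw [smul_eq_mul, mul_comm, pow_mul, C_pow, C_pow, C_pow]
    rw [h, coeff_monomial, coeff_monomial]
    split_ifs with hm
    · rw [hm]
    · rw [mul_zero]

theorem isWeightedHomogeneous_iff_eval {σ : Type*} (ω : σ → ℕ) (n : ℕ) (p : MvPolynomial σ ℂ) :
    IsWeightedHomogeneous ω p n ↔
      ∀ (c : ℂ) (x : σ → ℂ), eval (fun i => c ^ ω i * x i) p = c ^ n * eval x p := by
  have key : ∀ (c : ℂ) (x : σ → ℂ), eval (fun i => c ^ ω i * x i) p =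
      eval x (aeval (fun i => C (c ^ ω i) * X i : σ → MvPolynomial σ ℂ) p) := by
    intro c x
    rw [← coe_aeval_eq_eval, ← coe_aeval_eq_eval, RingHom.coe_coe, RingHom.coe_coe]
    change _ = aeval x (bind₁ _ p)
    rw [aeval_bind₁]
    simp
  constructor
  · intro hp c x
    rw [key, show aeval (fun i => C (c ^ ω i) * X i : σ → MvPolynomial σ ℂ) p = C (c ^ n) * p from ?_]
    · rw [map_mul, eval_C]
    · ext m
      rw [coeff_aeval_C_pow_mul_X, coeff_C_mul]
      by_cases hm : coeff m p = 0
      · rw [hm, mul_zero, mul_zero]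
      · rw [hp hm]
  · intro h m hm
    -- The single scaling `c = 2` suffices, since powers of `2` determine their exponents.
    have h2 : aeval (fun i => C ((2 : ℂ) ^ ω i) * X i : σ → MvPolynomial σ ℂ) p =
        C ((2 : ℂ) ^ n) * p :=
      MvPolynomial.funext fun x => by rw [← key, h, map_mul, eval_C]
    have h3 := congrArg (coeff m) h2
    rw [coeff_aeval_C_pow_mul_X, coeff_C_mul] at h3
    have h4 := mul_right_cancel₀ hm h3
    exact Nat.pow_right_injective le_rfl (by exact_mod_cast h4)

theorem isHomogeneous_iff_eval_smul {σ : Type*} {n : ℕ} {p : MvPolynomial σ ℂ} :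
    p.IsHomogeneous n ↔ ∀ (c : ℂ) (x : σ → ℂ), eval (c • x) p = c ^ n * eval x p := by
  refine (isWeightedHomogeneous_iff_eval 1 n p).trans ?_
  refine forall_congr' fun c => forall_congr' fun x => ?_
  simp only [Pi.one_apply, pow_one]
  rfl

theorem isWeightedHomogeneous_coeff_iff {n : ℕ} {F : MvPolynomial (Fin (d + 1) ⊕ Fin 2) ℂ} :
    IsWeightedHomogeneous (Sum.elim (fun _ => 1) (fun _ => 0) : _ → ℕ) F n ↔
      ∀ (c : ℂ) (a : Fin (d + 1) → ℂ) (v : Fin 2 → ℂ),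
        eval (Sum.elim (c • a) v) F = c ^ n * eval (Sum.elim a v) F := by
  have key : ∀ (c : ℂ) (x : Fin (d + 1) ⊕ Fin 2 → ℂ),
      (fun i => c ^ (Sum.elim (fun _ => 1) (fun _ => 0) : _ → ℕ) i * x i) =
        Sum.elim (c • (x ∘ Sum.inl)) (x ∘ Sum.inr) := by
    intro c x
    ext (i | i) <;> simp
  rw [isWeightedHomogeneous_iff_eval]
  constructor
  · intro h c a v
    have := h c (Sum.elim a v)
    rwa [key, Sum.elim_comp_inl, Sum.elim_comp_inr] at this
  · intro h c x
    rw [key, h, Sum.elim_comp_inl_inr]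

/-! Sections of `g ↦ g e₁` and the construction of covariants. -/

/-- The first basis vector. -/
def e₁ : Fin 2 → ℂ := ![1, 0]

/-- A matrix with first column `v`, for `v 0 ≠ 0`. -/
noncomputable def lift₀ (v : Fin 2 → ℂ) (hv : v 0 ≠ 0) : SL2 :=
  ⟨!![v 0, 0; v 1, (v 0)⁻¹], by simp [Matrix.det_fin_two, hv]⟩

/-- A matrix with first column `v`, for `v 1 ≠ 0`. -/
noncomputable def lift₁ (v : Fin 2 → ℂ) (hv : v 1 ≠ 0) : SL2 :=
  ⟨!![v 0, -(v 1)⁻¹; v 1, 0], by simp [Matrix.det_fin_two, hv]⟩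

theorem lift₀_mulVec (v : Fin 2 → ℂ) (hv : v 0 ≠ 0) : (lift₀ v hv).val.mulVec e₁ = v := by
  ext i
  fin_cases i <;> simp [lift₀, e₁, Matrix.mulVec, dotProduct]

theorem lift₁_mulVec (v : Fin 2 → ℂ) (hv : v 1 ≠ 0) : (lift₁ v hv).val.mulVec e₁ = v := by
  ext i
  fin_cases i <;> simp [lift₁, e₁, Matrix.mulVec, dotProduct]

theorem exists_mulVec_e₁_eq {v : Fin 2 → ℂ} (hv : v ≠ 0) : ∃ h : SL2, h.val.mulVec e₁ = v := by
  by_cases h0 : v 0 = 0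
  · have h1 : v 1 ≠ 0 := fun h1 => hv (by ext i; fin_cases i <;> simp [h0, h1])
    exact ⟨lift₁ v h1, lift₁_mulVec v h1⟩
  · exact ⟨lift₀ v h0, lift₀_mulVec v h0⟩

theorem mulVec_e₁_ne_zero (h : SL2) : h.val.mulVec e₁ ≠ 0 := by
  intro h0
  have h1 : (h⁻¹ * h).val.mulVec e₁ = 0 := by
    rw [Matrix.SpecialLinearGroup.coe_mul, ← Matrix.mulVec_mulVec, h0, Matrix.mulVec_zero]
  rw [inv_mul_cancel] at h1
  have := congrFun h1 0
  simp [e₁] at this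

theorem eq_unipotent_of_mulVec {k : SL2} (hk : k.val.mulVec e₁ = e₁) :
    k = unipotent (k.val 0 1) := by
  have h0 : k.val 0 0 = 1 := by simpa [e₁, Matrix.mulVec, dotProduct] using congrFun hk 0
  have h1 : k.val 1 0 = 0 := by simpa [e₁, Matrix.mulVec, dotProduct] using congrFun hk 1
  have hdet := k.2
  rw [Matrix.det_fin_two, h0, h1, one_mul, mul_zero, sub_zero] at hdet
  refine Matrix.SpecialLinearGroup.ext _ _ fun i j => ?_
  fin_cases i <;> fin_cases j <;> simp [unipotent, h0, h1, hdet]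

/-- Two matrices with the same first column differ by a unipotent, under which `s` is invariant;
this makes `F(f, h e₁) = s(h⁻¹ f)` well defined. -/
theorem eval_act_inv_congr {s : MvPolynomial (Fin (d + 1)) ℂ} (hs : D₁ d s = 0) {h h' : SL2}
    (hh : h.val.mulVec e₁ = h'.val.mulVec e₁) (a : Fin (d + 1) → ℂ) :
    eval (act d h⁻¹ a) s = eval (act d h'⁻¹ a) s := by
  have hk : (h⁻¹ * h').val.mulVec e₁ = e₁ := by
    rw [Matrix.SpecialLinearGroup.coe_mul, ← Matrix.mulVec_mulVec, ← hh, Matrix.mulVec_mulVec,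
      ← Matrix.SpecialLinearGroup.coe_mul, inv_mul_cancel, Matrix.SpecialLinearGroup.coe_one,
      Matrix.one_mulVec]
  have h1 : act d h⁻¹ a = act d (h⁻¹ * h') (act d h'⁻¹ a) := by
    rw [act_act, mul_assoc, mul_inv_cancel, mul_one]
  rw [h1, eq_unipotent_of_mulVec hk]
  exact (D₁_eq_zero_iff s).mp hs _ _

/-! ### From a seminvariant to a polynomial in forms and vectors -/

/-- Functions of `(a, v)` that become polynomial after multiplication by a power of `v j`. -/
def IsPolynomialAway (j : Fin 2) (φ : (Fin (d + 1) → ℂ) → (Fin 2 → ℂ) → ℂ) : Prop :=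
  ∃ (k : ℕ) (P : MvPolynomial (Fin (d + 1) ⊕ Fin 2) ℂ), ∀ a v, v j ≠ 0 →
    v j ^ k * φ a v = eval (Sum.elim a v) P

namespace IsPolynomialAway

variable {j : Fin 2} {φ ψ : (Fin (d + 1) → ℂ) → (Fin 2 → ℂ) → ℂ}

theorem of_eval (P : MvPolynomial (Fin (d + 1) ⊕ Fin 2) ℂ) :
    IsPolynomialAway j fun a v => eval (Sum.elim a v) P :=
  ⟨0, P, fun a v _ => by rw [pow_zero, one_mul]⟩

theorem inv : IsPolynomialAway (d := d) j fun _ v => (v j)⁻¹ :=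
  ⟨1, 1, fun a v hv => by rw [pow_one, mul_inv_cancel₀ hv, map_one]⟩

theorem mul (hφ : IsPolynomialAway j φ) (hψ : IsPolynomialAway j ψ) :
    IsPolynomialAway j fun a v => φ a v * ψ a v := by
  obtain ⟨k, P, hP⟩ := hφ
  obtain ⟨l, Q, hQ⟩ := hψ
  refine ⟨k + l, P * Q, fun a v hv => ?_⟩
  rw [map_mul, ← hP a v hv, ← hQ a v hv]
  ring

theorem add (hφ : IsPolynomialAway j φ) (hψ : IsPolynomialAway j ψ) :
    IsPolynomialAway j fun a v => φ a v + ψ a v := by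
  obtain ⟨k, P, hP⟩ := hφ
  obtain ⟨l, Q, hQ⟩ := hψ
  refine ⟨k + l, X (Sum.inr j) ^ l * P + X (Sum.inr j) ^ k * Q, fun a v hv => ?_⟩
  rw [map_add, map_mul, map_mul, ← hP a v hv, ← hQ a v hv]
  simp only [map_pow, eval_X, Sum.elim_inr]
  ring

theorem eval_comp {τ : Type*} {x : τ → (Fin (d + 1) → ℂ) → (Fin 2 → ℂ) → ℂ}
    (hx : ∀ i, IsPolynomialAway j (x i)) (T : MvPolynomial τ ℂ) :
    IsPolynomialAway j fun a v => eval (fun i => x i a v) T := by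
  induction T using MvPolynomial.induction_on with
  | C r => simpa using of_eval (d := d) (j := j) (C r)
  | add p q hp hq => simpa using hp.add hq
  | mul_X p i hp => simpa using hp.mul (hx i)

theorem coeff (i : Fin (d + 1)) : IsPolynomialAway (d := d) j fun a _ => a i := by
  simpa using of_eval (j := j) (X (Sum.inl i) : MvPolynomial (Fin (d + 1) ⊕ Fin 2) ℂ)

theorem coordinate (i : Fin 2) : IsPolynomialAway (d := d) j fun _ v => v i := by
  simpa using of_eval (d := d) (j := j) (X (Sum.inr i))

theorem const (r : ℂ) : IsPolynomialAway (d := d) j fun _ _ => r := by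
  simpa using of_eval (d := d) (j := j) (C r)

theorem neg (hφ : IsPolynomialAway j φ) : IsPolynomialAway j fun a v => -φ a v := by
  simpa using (const (-1)).mul hφ

end IsPolynomialAway

theorem exists_polynomial_lift₀ (s : MvPolynomial (Fin (d + 1)) ℂ) :
    ∃ (k : ℕ) (P : MvPolynomial (Fin (d + 1) ⊕ Fin 2) ℂ), ∀ a v, ∀ hv : v 0 ≠ 0,
      v 0 ^ k * eval (act d (lift₀ v hv)⁻¹ a) s = eval (Sum.elim a v) P := by
  obtain ⟨T, hT⟩ := exists_eval_eq_eval_act s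
  let x : Fin (d + 1) ⊕ Fin 2 × Fin 2 → (Fin (d + 1) → ℂ) → (Fin 2 → ℂ) → ℂ :=
    Sum.elim (fun i a _ => a i) fun p _ v => !![v 0, 0; v 1, (v 0)⁻¹] p.1 p.2
  have hx : ∀ i, IsPolynomialAway 0 (x i) := by
    rintro (i | ⟨i, j⟩)
    · exact .coeff i
    · fin_cases i <;> fin_cases j
      · exact .coordinate 0
      · exact .const 0
      · exact .coordinate 1
      · exact .inv
  obtain ⟨k, P, hP⟩ := IsPolynomialAway.eval_comp hx T
  refine ⟨k, P, fun a v hv => ?_⟩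
  rw [← hP a v hv, hT, inv_inv]
  congr 3
  ext (i | p) <;> rfl

theorem exists_polynomial_lift₁ (s : MvPolynomial (Fin (d + 1)) ℂ) :
    ∃ (k : ℕ) (P : MvPolynomial (Fin (d + 1) ⊕ Fin 2) ℂ), ∀ a v, ∀ hv : v 1 ≠ 0,
      v 1 ^ k * eval (act d (lift₁ v hv)⁻¹ a) s = eval (Sum.elim a v) P := by
  obtain ⟨T, hT⟩ := exists_eval_eq_eval_act s
  let x : Fin (d + 1) ⊕ Fin 2 × Fin 2 → (Fin (d + 1) → ℂ) → (Fin 2 → ℂ) → ℂ :=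
    Sum.elim (fun i a _ => a i) fun p _ v => !![v 0, -(v 1)⁻¹; v 1, 0] p.1 p.2
  have hx : ∀ i, IsPolynomialAway 1 (x i) := by
    rintro (i | ⟨i, j⟩)
    · exact .coeff i
    · fin_cases i <;> fin_cases j
      · exact .coordinate 0
      · exact IsPolynomialAway.inv.neg
      · exact .coordinate 1
      · exact .const 0
  obtain ⟨k, P, hP⟩ := IsPolynomialAway.eval_comp hx T
  refine ⟨k, P, fun a v hv => ?_⟩
  rw [← hP a v hv, hT, inv_inv]
  congr 3
  ext (i | p) <;> rfl

/-- A seminvariant `s` is the leading coefficient of a polynomial `F` on forms and vectors. -/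
theorem exists_eval_mulVec_e₁_eq {s : MvPolynomial (Fin (d + 1)) ℂ} (hs : D₁ d s = 0) :
    ∃ F : MvPolynomial (Fin (d + 1) ⊕ Fin 2) ℂ, ∀ (h : SL2) (a : Fin (d + 1) → ℂ),
      eval (Sum.elim a (h.val.mulVec e₁)) F = eval (act d h⁻¹ a) s := by
  obtain ⟨k, P, hP⟩ := exists_polynomial_lift₀ s
  obtain ⟨l, Q, hQ⟩ := exists_polynomial_lift₁ s
  have hPQ : X (Sum.inr 1) ^ l * P = X (Sum.inr 0) ^ k * Q := by
    have hX : (X (Sum.inr 0) * X (Sum.inr 1) : MvPolynomial (Fin (d + 1) ⊕ Fin 2) ℂ) ≠ 0 :=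
      mul_ne_zero (X_ne_zero _) (X_ne_zero _)
    -- The factor `hX` makes both sides vanish off the overlap `v 0 ≠ 0`, `v 1 ≠ 0`, where the two
    -- charts agree.
    refine mul_left_cancel₀ hX (MvPolynomial.funext fun x => ?_)
    rw [← Sum.elim_comp_inl_inr x]
    set a := x ∘ Sum.inl
    set v := x ∘ Sum.inr
    simp only [map_mul, map_pow, eval_X, Sum.elim_inr]
    by_cases h0 : v 0 = 0
    · simp [h0]
    by_cases h1 : v 1 = 0
    · simp [h1]
    rw [← hP a v h0, ← hQ a v h1,
      eval_act_inv_congr hs ((lift₀_mulVec v h0).trans (lift₁_mulVec v h1).symm)]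
    ring
  have hndvd : ¬ (X (Sum.inr 0) : MvPolynomial (Fin (d + 1) ⊕ Fin 2) ℂ) ∣ X (Sum.inr 1) ^ l := by
    rintro ⟨R, hR⟩
    have := congrArg (eval (Sum.elim 0 ![0, 1])) hR
    simp at this
  -- The first coordinate is prime and does not divide a power of the second, so its `k`-th power
  -- divides `P`; the quotient is `F`.
  obtain ⟨F, rfl⟩ := (X_prime (R := ℂ)).pow_dvd_of_dvd_mul_left k hndvd ⟨Q, hPQ⟩
  have hQF : X (Sum.inr 1) ^ l * F = Q := by
    refine mul_left_cancel₀ (pow_ne_zero k (X_ne_zero (R := ℂ) (Sum.inr 0))) ?_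
    rw [← hPQ]
    ring
  subst hQF
  refine ⟨F, fun h a => ?_⟩
  set v := h.val.mulVec e₁ with hv
  by_cases h0 : v 0 = 0
  · have h1 : v 1 ≠ 0 := fun h1 =>
      mulVec_e₁_ne_zero h (by rw [← hv]; ext i; fin_cases i <;> simp [h0, h1])
    have := hQ a v h1
    simp only [map_mul, map_pow, eval_X, Sum.elim_inr] at this
    rw [← mul_left_cancel₀ (pow_ne_zero l h1) this]
    exact eval_act_inv_congr hs (lift₁_mulVec v h1) a
  · have := hP a v h0
    simp only [map_mul, map_pow, eval_X, Sum.elim_inr] at this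
    rw [← mul_left_cancel₀ (pow_ne_zero k h0) this]
    exact eval_act_inv_congr hs (lift₀_mulVec v h0) a

/-! ### The isomorphism between covariants and seminvariants -/

/-- The orbit of `e₁` contains all nonzero vectors, a dense set. -/
theorem eq_of_eq_on_orbit {φ ψ : (Fin 2 → ℂ) → ℂ} (hφ : Continuous φ) (hψ : Continuous ψ)
    (h : ∀ g : SL2, φ (g.val.mulVec e₁) = ψ (g.val.mulVec e₁)) (v : Fin 2 → ℂ) : φ v = ψ v := by
  refine congrFun (Continuous.ext_on (dense_compl_singleton (0 : Fin 2 → ℂ)) hφ hψ ?_) v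
  intro w hw
  obtain ⟨g, rfl⟩ := exists_mulVec_e₁_eq hw
  exact h g

theorem continuous_eval_sumElim (F : MvPolynomial (Fin (d + 1) ⊕ Fin 2) ℂ)
    (a : Fin (d + 1) → ℂ) {y : (Fin 2 → ℂ) → Fin 2 → ℂ} (hy : Continuous y) :
    Continuous fun v => eval (Sum.elim a (y v)) F := by
  refine (continuous_eval F).comp (continuous_pi ?_)
  rintro (i | i)
  · exact continuous_const
  · exact (continuous_apply i).comp hy

/-- The leading coefficient `F(f, e₁)`. -/
noncomputable def leadingCoeff (d : ℕ) :
    MvPolynomial (Fin (d + 1) ⊕ Fin 2) ℂ →ₐ[ℂ] MvPolynomial (Fin (d + 1)) ℂ :=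
  aeval (Sum.elim X fun j => C (e₁ j))

theorem eval_leadingCoeff (F : MvPolynomial (Fin (d + 1) ⊕ Fin 2) ℂ) (a : Fin (d + 1) → ℂ) :
    eval a (leadingCoeff d F) = eval (Sum.elim a e₁) F := by
  rw [leadingCoeff, ← coe_aeval_eq_eval, ← coe_aeval_eq_eval, RingHom.coe_coe, RingHom.coe_coe]
  change aeval a (bind₁ _ F) = _
  rw [aeval_bind₁]
  congr 2
  ext (i | i) <;> simp

theorem leadingCoeff_mem {n : ℕ} {F : MvPolynomial (Fin (d + 1) ⊕ Fin 2) ℂ}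
    (hF : F ∈ covariantsOfDegree d n) : leadingCoeff d F ∈ seminvariantsOfDegree d n := by
  obtain ⟨hcov, hdeg⟩ := hF
  refine ⟨(D₁_eq_zero_iff _).mpr fun t a => ?_, isHomogeneous_iff_eval_smul.mpr fun c a => ?_⟩
  · rw [eval_leadingCoeff, eval_leadingCoeff, ← hcov (unipotent t) a e₁]
    congr 3
    ext i
    fin_cases i <;> simp [unipotent, e₁, Matrix.mulVec, dotProduct]
  · rw [eval_leadingCoeff, eval_leadingCoeff]
    exact isWeightedHomogeneous_coeff_iff.mp hdeg c a e₁

/-- Covariance gives `F(f, g e₁) = F(g⁻¹ f, e₁) = 0`. -/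
theorem eq_zero_of_leadingCoeff_eq_zero {F : MvPolynomial (Fin (d + 1) ⊕ Fin 2) ℂ}
    (hF : F ∈ covariants d) (h : leadingCoeff d F = 0) : F = 0 := by
  refine MvPolynomial.funext fun x => ?_
  rw [← Sum.elim_comp_inl_inr x, map_zero]
  refine eq_of_eq_on_orbit (φ := fun v => eval (Sum.elim (x ∘ Sum.inl) v) F) (ψ := fun _ => 0)
    (continuous_eval_sumElim F _ continuous_id) continuous_const (fun g => ?_) _
  have := hF g (act d g⁻¹ (x ∘ Sum.inl)) e₁
  rw [act_act_inv] at this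
  rw [this, ← eval_leadingCoeff, h, map_zero]

theorem exists_leadingCoeff_eq {n : ℕ} {s : MvPolynomial (Fin (d + 1)) ℂ}
    (hs : s ∈ seminvariantsOfDegree d n) : ∃ F ∈ covariantsOfDegree d n, leadingCoeff d F = s := by
  obtain ⟨h0, hdeg⟩ := hs
  obtain ⟨F, hF⟩ := exists_eval_mulVec_e₁_eq h0
  refine ⟨F, ⟨fun g a v => ?_, ?_⟩, MvPolynomial.funext fun a => ?_⟩
  · refine eq_of_eq_on_orbit
      (φ := fun v => eval (Sum.elim (act d g a) (g.val.mulVec v)) F)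
      (continuous_eval_sumElim F _ (by fun_prop))
      (continuous_eval_sumElim F _ continuous_id) (fun h => ?_) v
    simp only [id]
    -- Covariance on the orbit reads `s((g h)⁻¹ g f) = s(h⁻¹ f)`.
    rw [Matrix.mulVec_mulVec, ← Matrix.SpecialLinearGroup.coe_mul, hF, hF, act_act]
    congr 3
    group
  · refine isWeightedHomogeneous_coeff_iff.mpr fun c a v => ?_
    refine eq_of_eq_on_orbit (φ := fun v => eval (Sum.elim (c • a) v) F)
      (ψ := fun v => c ^ n * eval (Sum.elim a v) F)
      (continuous_eval_sumElim F _ continuous_id)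
      (continuous_const.mul (continuous_eval_sumElim F _ continuous_id)) (fun h => ?_) v
    rw [hF, hF, act_smul]
    exact isHomogeneous_iff_eval_smul.mp hdeg c _
  · have := hF 1 a
    rw [Matrix.SpecialLinearGroup.coe_one, Matrix.one_mulVec, inv_one, act_one] at this
    rw [eval_leadingCoeff, this]

/-- Taking leading coefficients identifies covariants with seminvariants. -/
noncomputable def covariantsEquivSeminvariants (d n : ℕ) :
    covariantsOfDegree d n ≃ₗ[ℂ] seminvariantsOfDegree d n :=
  LinearEquiv.ofBijective
    ((leadingCoeff d).toLinearMap.restrict fun _ hF => leadingCoeff_mem hF)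
    ⟨(injective_iff_map_eq_zero _).mpr fun F hF => Subtype.ext
        (eq_zero_of_leadingCoeff_eq_zero F.2.1 (congrArg Subtype.val hF)),
      fun s => by
        obtain ⟨F, hF, h⟩ := exists_leadingCoeff_eq s.2
        exact ⟨⟨F, hF⟩, Subtype.ext h⟩⟩

end Action

end BinaryForms

theorem theorem2 (d n : ℕ) :
    (Module.Finite ℂ (BinaryForms.covariantsOfDegree d n) ∧
      (Module.finrank ℂ (BinaryForms.covariantsOfDegree d n) : ℂ) =
        BinaryForms.diagCoeff d n (BinaryForms.genSeries d)) ∧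
    (Module.Finite ℂ (BinaryForms.seminvariantsOfDegree d n) ∧
      (Module.finrank ℂ (BinaryForms.seminvariantsOfDegree d n) : ℂ) =
        BinaryForms.diagCoeff d n (BinaryForms.genSeries d)) := by
  have hfin := BinaryForms.seminvariantsOfDegree_finite (d := d) n
  have hdim : (Module.finrank ℂ (BinaryForms.seminvariantsOfDegree d n) : ℂ) =
      BinaryForms.diagCoeff d n (BinaryForms.genSeries d) := by
    rw [BinaryForms.finrank_seminvariantsOfDegree, BinaryForms.diagCoeff_genSeries]
  have e := BinaryForms.covariantsEquivSeminvariants d n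
  exact ⟨⟨Module.Finite.equiv e.symm, by rw [e.finrank_eq, hdim]⟩, hfin, hdim⟩
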